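/- All graphs are finite, simple and undirected. For a graph $G$, let $\rho(G)$ denote the largest eigenvalue of its adjacency matrix. For a function $p:V(G)\to\mathbb{Z}^+$, a fractional $p$-factor of $G$ is a spanning subgraph with edge set $\{e\in E(G): h(e)>0\}$, where $h:E(G)\to[0,1]$ is a function satisfying $\sum_{e\ni v}h(e)=p(v)$ for every vertex $v$. We say that $G$ has all fractional $[a,b]$-factors if $G$ has a fractional $p$-factor for every $p:V(G)\to\mathbb{Z}^+$ with $a\le p(v)\le b$ for all $v\in V(G)$. For $2\le b\le n-1$ let $H_{n,b}=K_{b-1}\nabla(K_1\cup K_{n-b})$, where $\cup$ denotes the disjoint union and $\nabla$ the join of graphs (the disjoint union together with all edges between the two graphs). **Theorem 1.8.** Let $1\le a<b$ be integers, and let $G$ be a graph of order $n\ge \frac{3b(b+a+1)}{a}+7$. If $\rho(G)\ge\rho(H_{n,b})$, then $G$ has all fractional $[a,b]$-factors unless $G\cong H_{n,b}$, in which case it does not. That is, under these hypotheses, $G$ has all fractional $[a,b]$-factors if and only if $G\not\cong H_{n,b}$. -/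

import Mathlib

namespace FracFactor

/-- The join `G ∇ H`: the disjoint union of `G` and `H` with all edges between them added. -/
def join {V W : Type*} (G : SimpleGraph V) (H : SimpleGraph W) : SimpleGraph (V ⊕ W) :=
  (G ⊕g H) ⊔ completeBipartiteGraph V W

/-- The graph `H_{n,b} = K_{b-1} ∇ (K_1 ∪ K_{n-b})`, meant for `2 ≤ b ≤ n - 1`
(so that the natural subtractions are genuine). -/
def extremalGraph (n b : ℕ) : SimpleGraph (Fin (b - 1) ⊕ (Fin 1 ⊕ Fin (n - b))) :=
  join (SimpleGraph.completeGraph (Fin (b - 1)))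
    (SimpleGraph.completeGraph (Fin 1) ⊕g SimpleGraph.completeGraph (Fin (n - b)))

open Classical in
/-- The set of eigenvalues of the adjacency matrix of a finite graph. -/
def adjEigenvalues {V : Type*} [Fintype V] (G : SimpleGraph V) : Set ℝ :=
  {μ : ℝ | Module.End.HasEigenvalue (Matrix.toLin' (G.adjMatrix ℝ)) μ}

/-- The spectral radius `ρ(G)`: the largest eigenvalue of the adjacency matrix. -/
noncomputable def rho {V : Type*} [Fintype V] (G : SimpleGraph V) : ℝ :=
  sSup (adjEigenvalues G)

/-- On a non-empty vertex set `ρ(G)` really is the largest eigenvalue. -/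
theorem isGreatest_rho {V : Type*} [Fintype V] [Nonempty V] (G : SimpleGraph V) :
    IsGreatest (adjEigenvalues G) (rho G) := by
  classical
  have hA : (G.adjMatrix ℝ).IsHermitian := G.isHermitian_adjMatrix ℝ
  have hset : adjEigenvalues G = Set.range hA.eigenvalues := by
    rw [← hA.spectrum_real_eq_range_eigenvalues, ← Matrix.spectrum_toLin']
    ext μ
    rw [← Module.End.hasEigenvalue_iff_mem_spectrum]
    unfold adjEigenvalues
    simp only [Set.mem_ofPred_eq]
  have hfin : (adjEigenvalues G).Finite := by
    rw [hset]
    exact Set.finite_range _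
  have hne : (adjEigenvalues G).Nonempty := by
    rw [hset]
    exact Set.range_nonempty _
  exact ⟨hne.csSup_mem hfin, fun _ hx => le_csSup hfin.bddAbove hx⟩

open Classical in
/-- `h` is the indicator function of a fractional `(g, f)`-factor of `G`: it takes values in
`[0, 1]` on the edges, and at each vertex `v` the sum of `h` over the edges incident with `v`
lies between `g v` and `f v`. Only the values of `h` on the edges of `G` are used. -/
def IsFractionalIndicator {V : Type*} [Fintype V] (G : SimpleGraph V) (g f : V → ℕ)
    (h : Sym2 V → ℝ) : Prop :=
  (∀ e ∈ G.edgeSet, 0 ≤ h e ∧ h e ≤ 1) ∧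
    ∀ v, (g v : ℝ) ≤ ∑ e ∈ G.incidenceFinset v, h e ∧
      ∑ e ∈ G.incidenceFinset v, h e ≤ (f v : ℝ)

/-- `F` is a fractional `(g, f)`-factor of `G`: the spanning subgraph whose edges are the
edges `e` of `G` with `h e > 0`, for the indicator function `h` of such a factor. -/
def IsFractionalFactor {V : Type*} [Fintype V] (G : SimpleGraph V) (g f : V → ℕ)
    (F : SimpleGraph V) : Prop :=
  ∃ h : Sym2 V → ℝ, IsFractionalIndicator G g f h ∧ F.edgeSet = {e ∈ G.edgeSet | 0 < h e}

/-- `G` has a fractional `p`-factor, that is, a fractional `(p, p)`-factor. -/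
def HasFractionalFactor {V : Type*} [Fintype V] (G : SimpleGraph V) (p : V → ℕ) : Prop :=
  ∃ F : SimpleGraph V, IsFractionalFactor G p p F

/-- `G` has all fractional `[a, b]`-factors: it has a fractional `p`-factor for every
positive integer valued `p` with `a ≤ p ≤ b`. -/
def HasAllFractionalFactors {V : Type*} [Fintype V] (G : SimpleGraph V) (a b : ℕ) : Prop :=
  ∀ p : V → ℕ, (∀ v, 0 < p v) → (∀ v, a ≤ p v ∧ p v ≤ b) → HasFractionalFactor G p

end FracFactor

namespace FracFactor

/-! ### The cut criterion for fractional factors, by linear duality. -/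

section FractionalFactors

/-! If no fractional `p`-factor exists, `hasFractionalFactor_of_cut` yields disjoint sets S, T with
p(T) > p(S) + d, where d is the sum over T of the degrees in G - S. Since a ≤ p ≤ b and all terms
are integers, a|S| + d + 1 ≤ b|T|, so T is nonempty.

If T = {x}, then deg x ≤ |S| + d ≤ b - 1. Hence G is a spanning subgraph of a copy of H_{n,b}, and
strict monotonicity of ρ (`rho_lt_rho_of_lt`) turns the spectral hypothesis into G ≅ H_{n,b}.

If |T| ≥ 2, so few edges join T to the complement of S that, for n this large, G misses at least n -
1 edges (`sum_degree_le_of_cut`, `cut_bound_of_two_le`). But ρ(H_{n,b}) > n - 2, because H_{n,b}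
contains K_{n-1} and an edge at the remaining vertex, so `lt_sum_degree_of_lt_rho` allows fewer than
n - 1 missing edges.

Conversely, H_{n,b} has a vertex of degree b - 1, which rules out the constant function p = b. -/

open Classical in
theorem sum_incidenceFinset_eq {V : Type*} [Fintype V] (G : SimpleGraph V) (h : Sym2 V → ℝ)
    (v : V) :
    ∑ e ∈ G.incidenceFinset v, h e = ∑ w, if G.Adj v w then h s(v, w) else 0 := by
  rw [← Finset.sum_filter]
  symm
  refine Finset.sum_bij (fun w _ => s(v, w)) ?_ ?_ ?_ ?_
  · intro w hw
    simpa using hw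
  · intro w₁ _ w₂ _ hw
    exact Sym2.congr_right.1 hw
  · intro e he
    induction e with
    | _ x y =>
      rw [SimpleGraph.mem_incidenceFinset, SimpleGraph.mk'_mem_incidenceSet_iff] at he
      obtain ⟨hxy, rfl | rfl⟩ := he
      · exact ⟨y, by simpa using hxy, rfl⟩
      · exact ⟨x, by simpa using hxy.symm, Sym2.eq_swap⟩
  · intro w _
    rfl

/-- The degrees that a weighting of the edges induces at the vertices. -/
noncomputable def weightedDegree {V : Type*} [Fintype V] (G : SimpleGraph V) :
    (Sym2 V → ℝ) →ₗ[ℝ] (V → ℝ) :=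
  open Classical in
  { toFun := fun h v => ∑ e ∈ G.incidenceFinset v, h e
    map_add' := fun h k => by
      ext v
      simp [Finset.sum_add_distrib]
    map_smul' := fun c h => by
      ext v
      simp [Finset.mul_sum] }

-- The degree vectors of weightings in the cube [0,1]^E form a compact convex set, so a hyperplane
-- with normal `y` separates `p` from it. The left side is the value of `y` at the best weighting,
-- which puts 1 exactly on the edges with positive endpoint sum.
open Classical in
theorem exists_separating_weight {V : Type*} [Fintype V] (G : SimpleGraph V) (p : V → ℕ)
    (hp : ¬ HasFractionalFactor G p) :
    ∃ y : V → ℝ, (∑ v, ∑ w, if G.Adj v w ∧ 0 < y v + y w then y v else 0)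
      < ∑ v, (p v : ℝ) * y v := by
  have hcomp : IsCompact (weightedDegree G '' Set.Icc 0 1) :=
    isCompact_Icc.image (LinearMap.continuous_of_finiteDimensional _)
  have hconv : Convex ℝ (weightedDegree G '' Set.Icc 0 1) :=
    (convex_Icc 0 1).linear_image _
  have hnot : (fun v => (p v : ℝ)) ∉ weightedDegree G '' Set.Icc 0 1 := by
    rintro ⟨h, ⟨h0, h1⟩, hh⟩
    have hinc : ∀ v, ∑ e ∈ G.incidenceFinset v, h e = (p v : ℝ) := fun v => congrFun hh v
    refine hp ⟨SimpleGraph.fromEdgeSet {e ∈ G.edgeSet | 0 < h e}, h, ⟨fun e _ => ⟨h0 e, h1 e⟩,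
      fun v => ⟨(hinc v).ge, (hinc v).le⟩⟩, ?_⟩
    rw [SimpleGraph.edgeSet_fromEdgeSet, sdiff_eq_left, Set.disjoint_left]
    intro e he hd
    exact G.not_isDiag_of_mem_edgeSet he.1 hd
  obtain ⟨f, u, hfu, huf⟩ := geometric_hahn_banach_closed_point hconv hcomp.isClosed hnot
  refine ⟨fun v => f (Pi.single v 1), ?_⟩
  have hf : ∀ x : V → ℝ, f x = ∑ v, x v * f (Pi.single v 1) := by
    intro x
    have := LinearMap.pi_apply_eq_sum_univ (f : (V → ℝ) →ₗ[ℝ] ℝ) x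
    simp only [ContinuousLinearMap.coe_coe, smul_eq_mul] at this
    rw [this]
    refine Finset.sum_congr rfl fun v _ => ?_
    congr 2
    ext w
    simp [Pi.single_apply, eq_comm]
  set y : V → ℝ := fun v => f (Pi.single v 1) with hy
  -- This weighting maximises the functional over the cube.
  let h : Sym2 V → ℝ := Sym2.lift ⟨fun v w => if 0 < y v + y w then 1 else 0, fun v w => by
    simp only [add_comm]⟩
  have hmem : h ∈ Set.Icc (0 : Sym2 V → ℝ) 1 := by
    constructor <;> intro e <;> induction e with
    | _ v w =>
      simp only [h, Sym2.lift_mk, Pi.zero_apply, Pi.one_apply]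
      split_ifs <;> norm_num
  have hlt := (hfu _ ⟨h, hmem, rfl⟩).trans huf
  rw [hf, hf] at hlt
  refine lt_of_eq_of_lt (Finset.sum_congr rfl fun v _ => ?_) hlt
  change _ = (∑ e ∈ G.incidenceFinset v, h e) * y v
  rw [sum_incidenceFinset_eq, Finset.sum_mul]
  refine Finset.sum_congr rfl fun w _ => ?_
  simp only [h, Sym2.lift_mk]
  by_cases hA : G.Adj v w <;> by_cases hpos : 0 < y v + y w <;>
    simp only [hA, hpos, true_and, false_and, if_true, if_false, one_mul, zero_mul]

open MeasureTheory in
theorem integrable_indicator_Ioo (c d : ℝ) :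
    Integrable ((Set.Ioo c d).indicator (fun _ => (1 : ℝ))) :=
  (integrable_indicator_iff measurableSet_Ioo).2 (by simp)

open MeasureTheory in
theorem integral_indicator_Ioo (c d : ℝ) :
    ∫ θ, (Set.Ioo c d).indicator (fun _ => (1 : ℝ)) θ = max (d - c) 0 := by
  rw [integral_indicator measurableSet_Ioo]
  simp [Real.volume_real_Ioo]

open Classical MeasureTheory in
/-- The cut condition for all pairs of disjoint vertex sets gives the dual inequality for all real
weights: integrate it over the level sets of the weight. -/
theorem sum_mul_le_of_cut {V : Type*} [Fintype V] (G : SimpleGraph V) (p : V → ℕ)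
    (hcut : ∀ S T : Finset V, Disjoint S T →
      ∑ v ∈ T, p v ≤ ∑ v ∈ S, p v + ∑ v ∈ T, ∑ w ∈ Sᶜ, if G.Adj v w then 1 else 0)
    (y : V → ℝ) :
    ∑ v, (p v : ℝ) * y v ≤ ∑ v, ∑ w, if G.Adj v w ∧ 0 < y v + y w then y v else 0 := by
  let I : ℝ → ℝ → ℝ → ℝ := fun c d => (Set.Ioo c d).indicator (fun _ => (1 : ℝ))
  have hI : ∀ c d, Integrable (I c d) := integrable_indicator_Ioo
  -- For θ > 0 this is the cut condition with S = {y < -θ} and T = {y > θ}. The finitely many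
  -- excluded θ make membership in the complement of S the strict inequality -y w < θ.
  have hpt : ∀ θ : ℝ, θ ∉ Set.range (fun v => - y v) → ∑ v, (p v : ℝ) * I 0 (y v) θ ≤
      ∑ v, (p v : ℝ) * I 0 (- y v) θ +
        ∑ v, ∑ w, if G.Adj v w then I (max 0 (- y w)) (y v) θ else 0 := by
    intro θ hθ
    by_cases h0 : 0 < θ
    · have hS := hcut ({v | θ < - y v} : Finset V) ({v | θ < y v} : Finset V) (by
        rw [Finset.disjoint_left]
        intro v h1 h2
        simp only [Finset.mem_filter, Finset.mem_univ, true_and] at h1 h2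
        linarith)
      have hS' : (∑ v ∈ ({v | θ < y v} : Finset V), (p v : ℝ)) ≤
          ∑ v ∈ ({v | θ < - y v} : Finset V), (p v : ℝ) + ∑ v ∈ ({v | θ < y v} : Finset V),
            ∑ w ∈ ({v | θ < - y v} : Finset V)ᶜ, if G.Adj v w then (1 : ℝ) else 0 := by
        exact_mod_cast hS
      rw [Finset.compl_filter] at hS'
      simp only [Finset.sum_filter] at hS'
      refine hS'.trans_eq' ?_ |>.trans_eq ?_
      · refine Finset.sum_congr rfl fun v _ => ?_
        simp [I, Set.indicator_apply, h0]
      · congr 1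
        · refine Finset.sum_congr rfl fun v _ => ?_
          simp [I, Set.indicator_apply, h0]
        · refine Finset.sum_congr rfl fun v _ => ?_
          by_cases hv : θ < y v
          · rw [if_pos hv]
            refine Finset.sum_congr rfl fun w _ => ?_
            have : θ ≠ - y w := fun h => hθ ⟨w, h.symm⟩
            have hlt : ¬ θ < - y w ↔ - y w < θ :=
              ⟨fun h => lt_of_le_of_ne (not_lt.1 h) this.symm, fun h => h.le.not_gt⟩
            simp only [hlt, I, Set.indicator_apply, Set.mem_Ioo, max_lt_iff, h0, hv, and_true,
              true_and]
            split_ifs <;> rfl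
          · simp [hv, I]
    · have hz : ∀ c d : ℝ, 0 ≤ c → I c d θ = 0 := by
        intro c d hc
        simp only [I, Set.indicator_apply, Set.mem_Ioo, ite_eq_right_iff, and_imp]
        intro h
        linarith
      simp [hz]
  have hae : ∀ᵐ θ : ℝ, θ ∉ Set.range (fun v => - y v) :=
    measure_eq_zero_iff_ae_notMem.1 ((Set.finite_range _).measure_zero volume)
  have hite : ∀ v w, Integrable (fun θ => if G.Adj v w then I (max 0 (- y w)) (y v) θ else 0) := by
    intro v w
    by_cases h : G.Adj v w
    · simpa [h] using hI _ _
    · simp [h]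
  have h1 : Integrable (fun θ => ∑ v, (p v : ℝ) * I 0 (y v) θ) :=
    integrable_finsetSum _ fun v _ => (hI _ _).const_mul _
  have h2 : Integrable (fun θ => ∑ v, (p v : ℝ) * I 0 (- y v) θ) :=
    integrable_finsetSum _ fun v _ => (hI _ _).const_mul _
  have h3 : Integrable (fun θ =>
      ∑ v, ∑ w, if G.Adj v w then I (max 0 (- y w)) (y v) θ else 0) :=
    integrable_finsetSum _ fun v _ => integrable_finsetSum _ fun w _ => hite v w
  have hint := integral_mono_ae h1 (h2.add h3) (hae.mono fun θ hθ => hpt θ hθ)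
  simp only [Pi.add_apply] at hint
  rw [integral_add h2 h3, integral_finsetSum _ fun v _ => (hI _ _).const_mul _,
    integral_finsetSum _ fun v _ => (hI _ _).const_mul _,
    integral_finsetSum _ fun v _ => integrable_finsetSum _ fun w _ => hite v w] at hint
  have hval : ∀ v w, ∫ θ, (if G.Adj v w then I (max 0 (- y w)) (y v) θ else 0) =
      if G.Adj v w then max (y v - max 0 (- y w)) 0 else 0 := by
    intro v w
    split_ifs
    · exact integral_indicator_Ioo _ _
    · simp
  have hval' : ∀ v, ∫ θ, ∑ w, (if G.Adj v w then I (max 0 (- y w)) (y v) θ else 0) =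
      ∑ w, if G.Adj v w then max (y v - max 0 (- y w)) 0 else 0 := by
    intro v
    rw [integral_finsetSum _ fun w _ => hite v w]
    exact Finset.sum_congr rfl fun w _ => hval v w
  simp only [hval', integral_const_mul] at hint
  simp only [I, integral_indicator_Ioo, sub_zero] at hint
  have hsplit : ∑ v, (p v : ℝ) * y v =
      ∑ v, (p v : ℝ) * max (y v) 0 - ∑ v, (p v : ℝ) * max (- y v) 0 := by
    rw [← Finset.sum_sub_distrib]
    refine Finset.sum_congr rfl fun v _ => ?_
    rw [← mul_sub]
    congr 1
    rcases le_total (y v) 0 with h | h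
    · rw [max_eq_right h, max_eq_left (by linarith)]; ring
    · rw [max_eq_left h, max_eq_right (by linarith)]; ring
  have hsymm : ∀ F : V → V → ℝ, 2 * ∑ v, ∑ w, F v w = ∑ v, ∑ w, (F v w + F w v) := by
    intro F
    simp only [Finset.sum_add_distrib]
    rw [Finset.sum_comm (f := fun v w => F w v)]
    ring
  -- Only after symmetrising do the summands agree: on an edge vw, both sides contribute the
  -- positive part of y v + y w.
  have hkey : 2 * ∑ v, ∑ w, (if G.Adj v w then max (y v - max 0 (- y w)) 0 else 0) =
      2 * ∑ v, ∑ w, if G.Adj v w ∧ 0 < y v + y w then y v else 0 := by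
    rw [hsymm, hsymm]
    refine Finset.sum_congr rfl fun v _ => Finset.sum_congr rfl fun w _ => ?_
    rw [G.adj_comm w v, add_comm (y w) (y v)]
    by_cases hA : G.Adj v w
    · simp only [hA, if_true, true_and, max_def]
      split_ifs <;> linarith
    · simp [hA]
  linarith

open Classical in
/-- A cut criterion for fractional `p`-factors. -/
theorem hasFractionalFactor_of_cut {V : Type*} [Fintype V] (G : SimpleGraph V) (p : V → ℕ)
    (hcut : ∀ S T : Finset V, Disjoint S T →
      ∑ v ∈ T, p v ≤ ∑ v ∈ S, p v + ∑ v ∈ T, ∑ w ∈ Sᶜ, if G.Adj v w then 1 else 0) :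
    HasFractionalFactor G p := by
  by_contra hp
  obtain ⟨y, hy⟩ := exists_separating_weight G p hp
  exact (sum_mul_le_of_cut G p hcut y).not_gt hy

open Classical in
theorem HasFractionalFactor.le_degree {V : Type*} [Fintype V] {G : SimpleGraph V} {p : V → ℕ}
    (hp : HasFractionalFactor G p) (v : V) : p v ≤ G.degree v := by
  obtain ⟨F, h, ⟨h01, hv⟩, -⟩ := hp
  have : (p v : ℝ) ≤ G.degree v := by
    refine (hv v).1.trans ?_
    rw [← G.card_incidenceFinset_eq_degree v, Finset.card_eq_sum_ones, Nat.cast_sum]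
    refine Finset.sum_le_sum fun e he => ?_
    have := (h01 e (G.incidenceSet_subset v ((G.mem_incidenceFinset v e).1 he))).2
    simpa using this
  exact_mod_cast this

end FractionalFactors

/-! ### Rayleigh quotients, strict monotonicity and row-sum bounds for the spectral radius. -/

section SpectralRadius

theorem adjMatrix_mulVec_eq_sum {V : Type*} [Fintype V] (G : SimpleGraph V)
    [DecidableRel G.Adj] (x : V → ℝ) (v : V) :
    (G.adjMatrix ℝ).mulVec x v = ∑ w, if G.Adj v w then x w else 0 := by
  simp [Matrix.mulVec, dotProduct, SimpleGraph.adjMatrix_apply]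

theorem mem_adjEigenvalues_iff {V : Type*} [Fintype V] (G : SimpleGraph V) [DecidableRel G.Adj]
    (μ : ℝ) : μ ∈ adjEigenvalues G ↔
      ∃ x : V → ℝ, x ≠ 0 ∧ ∀ v, (∑ w, if G.Adj v w then x w else 0) = μ * x v := by
  classical
  have hmul : ∀ x : V → ℝ, ∀ v, Matrix.toLin' (G.adjMatrix ℝ) x v =
      ∑ w, if G.Adj v w then x w else 0 := fun x v => adjMatrix_mulVec_eq_sum G x v
  have hiff : μ ∈ adjEigenvalues G ↔
      Module.End.HasEigenvalue (Matrix.toLin' (G.adjMatrix ℝ)) μ := by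
    unfold adjEigenvalues
    simp only [Set.mem_ofPred_eq]
    congr!
  rw [hiff]
  constructor
  · intro h
    obtain ⟨x, hx⟩ := h.exists_hasEigenvector
    refine ⟨x, hx.2, fun v => ?_⟩
    rw [← hmul, hx.apply_eq_smul]
    rfl
  · rintro ⟨x, hx, h⟩
    refine Module.End.hasEigenvalue_of_hasEigenvector (x := x) ⟨?_, hx⟩
    rw [Module.End.mem_eigenspace_iff]
    ext v
    rw [hmul, h]
    rfl

theorem exists_rho_eigenvector {V : Type*} [Fintype V] [Nonempty V] (G : SimpleGraph V)
    [DecidableRel G.Adj] :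
    ∃ x : V → ℝ, x ≠ 0 ∧ ∀ v, (∑ w, if G.Adj v w then x w else 0) = rho G * x v :=
  (mem_adjEigenvalues_iff G _).1 (isGreatest_rho G).1

theorem adjEigenvalues_subset_of_iso {V W : Type*} [Fintype V] [Fintype W] {G : SimpleGraph V}
    {H : SimpleGraph W} (e : G ≃g H) : adjEigenvalues G ⊆ adjEigenvalues H := by
  classical
  intro μ hμ
  obtain ⟨x, hx, h⟩ := (mem_adjEigenvalues_iff G μ).1 hμ
  refine (mem_adjEigenvalues_iff H μ).2 ⟨fun w => x (e.symm w), fun h0 => hx ?_, fun w => ?_⟩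
  · ext v
    simpa using congrFun h0 (e v)
  · rw [← h, ← Equiv.sum_comp e.symm.toEquiv]
    refine Finset.sum_congr rfl fun u _ => ?_
    change _ = if G.Adj (e.symm w) (e.symm u) then _ else _
    simp only [e.symm.map_adj_iff]
    rfl

theorem rho_congr {V W : Type*} [Fintype V] [Fintype W] {G : SimpleGraph V} {H : SimpleGraph W}
    (e : G ≃g H) : rho G = rho H :=
  congrArg sSup
    ((adjEigenvalues_subset_of_iso e).antisymm (adjEigenvalues_subset_of_iso e.symm))

theorem posSemidef_rho_sub_adjMatrix {V : Type*} [Fintype V] [DecidableEq V] (G : SimpleGraph V)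
    [DecidableRel G.Adj] :
    (Matrix.diagonal (fun _ => rho G) - G.adjMatrix ℝ).PosSemidef := by
  have hH : (Matrix.diagonal (fun _ => rho G) - G.adjMatrix ℝ).IsHermitian :=
    (Matrix.isHermitian_diagonal _).sub (G.isHermitian_adjMatrix ℝ)
  rw [hH.posSemidef_iff_eigenvalues_nonneg]
  intro i
  have : Nonempty V := ⟨i⟩
  have hv := hH.mulVec_eigenvectorBasis i
  set x : V → ℝ := (hH.eigenvectorBasis i).ofLp with hx
  have hx0 : x ≠ 0 := by
    intro h
    exact hH.eigenvectorBasis.orthonormal.ne_zero i (WithLp.ofLp_injective 2 h)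
  have hmem : rho G - hH.eigenvalues i ∈ adjEigenvalues G := by
    refine (mem_adjEigenvalues_iff G _).2 ⟨x, hx0, fun v => ?_⟩
    have h := congrFun hv v
    simp only [Matrix.sub_mulVec, Matrix.mulVec_diagonal, Pi.sub_apply, Pi.smul_apply,
      smul_eq_mul, adjMatrix_mulVec_eq_sum] at h
    linarith
  have := (isGreatest_rho G).2 hmem
  simpa using this

theorem dotProduct_rho_sub_adjMatrix {V : Type*} [Fintype V] [DecidableEq V] (G : SimpleGraph V)
    [DecidableRel G.Adj] (x : V → ℝ) :
    star x ⬝ᵥ (Matrix.diagonal (fun _ => rho G) - G.adjMatrix ℝ).mulVec x =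
      rho G * ∑ v, x v ^ 2 - ∑ v, ∑ w, if G.Adj v w then x v * x w else 0 := by
  rw [Matrix.sub_mulVec, dotProduct_sub]
  simp only [dotProduct, Matrix.mulVec_diagonal, adjMatrix_mulVec_eq_sum, star_trivial,
    Finset.mul_sum]
  congr 1
  · exact Finset.sum_congr rfl fun v _ => by ring
  · exact Finset.sum_congr rfl fun v _ => Finset.sum_congr rfl fun w _ => by simp

theorem sum_adj_mul_le_rho {V : Type*} [Fintype V] (G : SimpleGraph V)
    [DecidableRel G.Adj] (x : V → ℝ) :
    (∑ v, ∑ w, if G.Adj v w then x v * x w else 0) ≤ rho G * ∑ v, x v ^ 2 := by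
  classical
  have := (posSemidef_rho_sub_adjMatrix G).dotProduct_mulVec_nonneg x
  rw [dotProduct_rho_sub_adjMatrix] at this
  linarith

/-- Equality in the Rayleigh bound: a vector on which the positive semidefinite form of ρ - A
vanishes lies in the kernel of ρ - A. -/
theorem eq_rho_mul_of_le_sum {V : Type*} [Fintype V] (G : SimpleGraph V)
    [DecidableRel G.Adj] (x : V → ℝ)
    (hx : rho G * ∑ v, x v ^ 2 ≤ ∑ v, ∑ w, if G.Adj v w then x v * x w else 0) (v : V) :
    (∑ w, if G.Adj v w then x w else 0) = rho G * x v := by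
  classical
  have h := (posSemidef_rho_sub_adjMatrix G).dotProduct_mulVec_zero_iff x
  rw [dotProduct_rho_sub_adjMatrix] at h
  have := congrFun (h.1 (by linarith [sum_adj_mul_le_rho G x])) v
  simp only [Matrix.sub_mulVec, Matrix.mulVec_diagonal, Pi.sub_apply, Pi.zero_apply,
    adjMatrix_mulVec_eq_sum] at this
  linarith

/-- The spectral radius is strictly monotone below a graph that has a dominating vertex. -/
theorem rho_lt_rho_of_lt {V : Type*} [Fintype V] {G H : SimpleGraph V} (hGH : G < H) (c : V)
    (hc : ∀ v, v ≠ c → H.Adj c v) : rho G < rho H := by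
  classical
  have : Nonempty V := ⟨c⟩
  obtain ⟨z, hz0, hz⟩ := exists_rho_eigenvector G
  have hle := hGH.le
  obtain ⟨u, w, huw, hnuw⟩ : ∃ u w, H.Adj u w ∧ ¬ G.Adj u w := by
    by_contra! h
    exact hGH.not_ge fun u w => h u w
  have hterm : ∀ u w, (if G.Adj u w then z u * z w else 0) ≤
      if H.Adj u w then |z u| * |z w| else 0 := by
    intro u w
    by_cases hG : G.Adj u w
    · rw [if_pos hG, if_pos (hle hG), ← abs_mul]
      exact le_abs_self _
    · rw [if_neg hG]
      split_ifs <;> positivity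
  have hGsum : rho G * ∑ v, |z v| ^ 2 = ∑ v, ∑ w, if G.Adj v w then z v * z w else 0 := by
    simp only [sq_abs, Finset.mul_sum]
    refine Finset.sum_congr rfl fun v _ => ?_
    rw [pow_two, mul_left_comm, ← hz, Finset.mul_sum]
    exact Finset.sum_congr rfl fun w _ => by simp
  have hGH' : rho G * ∑ v, |z v| ^ 2 ≤ ∑ v, ∑ w, if H.Adj v w then |z v| * |z w| else 0 := by
    rw [hGsum]
    exact Finset.sum_le_sum fun v _ => Finset.sum_le_sum fun w _ => hterm v w
  by_contra! hcon
  -- If ρ(H) ≤ ρ(G), then |z| attains the Rayleigh bound of H and so is an eigenvector of H. The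
  -- dominating vertex `c` then makes it positive everywhere, and the extra edge of H contradicts
  -- equality.
  have hH := eq_rho_mul_of_le_sum H (fun v => |z v|)
    ((mul_le_mul_of_nonneg_right hcon (by positivity)).trans hGH')
  have hnn : ∀ v w, 0 ≤ if H.Adj v w then |z w| else 0 := by
    intro v w
    split_ifs <;> positivity
  have hcpos : 0 < |z c| := by
    rw [abs_pos]
    intro h0
    have hsum := hH c
    rw [h0, abs_zero, mul_zero, Finset.sum_eq_zero_iff_of_nonneg fun w _ => hnn c w] at hsum
    apply hz0
    ext v
    by_cases hv : v = c
    · rw [hv, h0]; rfl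
    · have := hsum v (Finset.mem_univ v)
      rw [if_pos (hc v hv)] at this
      simpa using this
  have hpos : ∀ v, 0 < |z v| := by
    intro v
    by_cases hv : v = c
    · rwa [hv]
    · have h1 : |z c| ≤ rho H * |z v| := by
        rw [← hH v]
        have := Finset.single_le_sum (fun w _ => hnn v w) (Finset.mem_univ c)
        rwa [if_pos (hc v hv).symm] at this
      refine lt_of_le_of_ne (abs_nonneg _) fun h0 => ?_
      rw [← h0, mul_zero] at h1
      linarith
  have hstrict : rho G * ∑ v, |z v| ^ 2 < ∑ v, ∑ w, if H.Adj v w then |z v| * |z w| else 0 := by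
    rw [hGsum]
    refine Finset.sum_lt_sum (fun v _ => Finset.sum_le_sum fun w _ => hterm v w)
      ⟨u, Finset.mem_univ u, Finset.sum_lt_sum (fun w _ => hterm u w) ⟨w, Finset.mem_univ w, ?_⟩⟩
    rw [if_neg hnuw, if_pos huw]
    exact mul_pos (hpos u) (hpos w)
  have h1 := sum_adj_mul_le_rho H (fun v => |z v|)
  have h2 : rho H * ∑ v, |z v| ^ 2 ≤ rho G * ∑ v, |z v| ^ 2 :=
    mul_le_mul_of_nonneg_right hcon (by positivity)
  linarith

/-- The spectral radius is at most a row sum of the adjacency matrix, and its square is at most the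
corresponding row sum of the squared matrix. -/
theorem exists_rho_le_degree {V : Type*} [Fintype V] [Nonempty V] (G : SimpleGraph V)
    [DecidableRel G.Adj] :
    ∃ v, rho G ≤ G.degree v ∧ rho G ^ 2 ≤ ∑ w ∈ G.neighborFinset v, (G.degree w : ℝ) := by
  obtain ⟨x, hx0, hx⟩ := exists_rho_eigenvector G
  -- An entry of largest modulus in an eigenvector supplies the row.
  obtain ⟨v, hv⟩ := Finite.exists_max fun v => |x v|
  have hvpos : 0 < |x v| := by
    obtain ⟨w, hw⟩ := Function.ne_iff.1 hx0
    exact (abs_pos.2 hw).trans_le (hv w)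
  have hrow : ∀ u, |rho G * x u| ≤ G.degree u * |x v| := by
    intro u
    rw [← hx u, ← Finset.sum_filter, ← G.neighborFinset_eq_filter]
    refine (Finset.abs_sum_le_sum_abs _ _).trans ?_
    refine (Finset.sum_le_card_nsmul _ _ _ fun w _ => hv w).trans_eq ?_
    simp
  refine ⟨v, ?_, ?_⟩
  · refine le_of_mul_le_mul_right ?_ hvpos
    refine le_trans ?_ (hrow v)
    rw [abs_mul]
    gcongr
    exact le_abs_self _
  · refine le_of_mul_le_mul_right ?_ hvpos
    calc rho G ^ 2 * |x v| = |rho G * (rho G * x v)| := by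
          rw [← mul_assoc, ← pow_two, abs_mul, abs_of_nonneg (sq_nonneg (rho G))]
      _ = |∑ w ∈ G.neighborFinset v, rho G * x w| := by
          rw [← hx v, ← Finset.sum_filter, ← G.neighborFinset_eq_filter, Finset.mul_sum]
      _ ≤ ∑ w ∈ G.neighborFinset v, |rho G * x w| := Finset.abs_sum_le_sum_abs _ _
      _ ≤ ∑ w ∈ G.neighborFinset v, (G.degree w : ℝ) * |x v| :=
          Finset.sum_le_sum fun w _ => hrow w
      _ = _ := by rw [Finset.sum_mul]

/-- Hong's bound for graphs of order `n` whose spectral radius exceeds `n - 2`: they miss fewer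
than `n - 1` edges. -/
theorem lt_sum_degree_of_lt_rho {V : Type*} [Fintype V] (G : SimpleGraph V) [DecidableRel G.Adj]
    (hcard : 2 ≤ Fintype.card V) (h : (Fintype.card V : ℝ) - 2 < rho G) :
    ((Fintype.card V : ℝ) - 2) ^ 2 + Fintype.card V - 1 < ∑ v, (G.degree v : ℝ) := by
  classical
  have : Nonempty V := Fintype.card_pos_iff.1 (by omega)
  have hn : (2 : ℝ) ≤ Fintype.card V := by exact_mod_cast hcard
  obtain ⟨v, hv1, hv2⟩ := exists_rho_le_degree G
  -- As ρ > n - 2, the chosen vertex is adjacent to all others, so ρ² is at most the degree sum of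
  -- the remaining vertices; its own degree n - 1 is added at the end.
  have hvn : Fintype.card V - 1 ≤ G.degree v := by
    have h1 : (Fintype.card V : ℝ) < G.degree v + 2 := by linarith
    have h2 : Fintype.card V < G.degree v + 2 := by exact_mod_cast h1
    omega
  have hadj : G.neighborFinset v = Finset.univ.erase v := by
    apply Finset.eq_of_subset_of_card_le
    · intro w hw
      rw [SimpleGraph.mem_neighborFinset] at hw
      simpa using hw.ne'
    · rw [Finset.card_erase_of_mem (Finset.mem_univ v), Finset.card_univ,
        SimpleGraph.card_neighborFinset_eq_degree]
      exact hvn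
  have hdeg : G.degree v = Fintype.card V - 1 := by
    rw [← SimpleGraph.card_neighborFinset_eq_degree, hadj,
      Finset.card_erase_of_mem (Finset.mem_univ v), Finset.card_univ]
  rw [hadj] at hv2
  have hsum := Finset.add_sum_erase Finset.univ (fun w => (G.degree w : ℝ)) (Finset.mem_univ v)
  simp only [hdeg] at hsum
  rw [Nat.cast_sub (by omega)] at hsum
  have : ((Fintype.card V : ℝ) - 2) ^ 2 < rho G ^ 2 := by
    apply pow_lt_pow_left₀ h (by linarith) (by norm_num)
  push_cast at hsum
  linarith

end SpectralRadius

/-! ### The graph H_{n,b}: its spectral radius, and the graphs it contains. -/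

section ExtremalGraph

theorem extremalGraph_adj_iff {n b : ℕ} (u v : Fin (b - 1) ⊕ (Fin 1 ⊕ Fin (n - b))) :
    (extremalGraph n b).Adj u v ↔ u ≠ v ∧ (u = Sum.inr (Sum.inl 0) → v.isLeft) ∧
      (v = Sum.inr (Sum.inl 0) → u.isLeft) := by
  rcases u with u | u | u <;> rcases v with v | v | v <;>
    simp [extremalGraph, join, SimpleGraph.completeGraph, Fin.fin_one_eq_zero]

theorem card_extremalGraph_vertices {n b : ℕ} (hb : 1 ≤ b) (hn : b ≤ n) :
    Fintype.card (Fin (b - 1) ⊕ (Fin 1 ⊕ Fin (n - b))) = n := by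
  simp only [Fintype.card_sum, Fintype.card_fin]
  omega

/-- A clique on all vertices but one, together with an edge at that vertex, forces the spectral
radius above that of the clique. -/
theorem card_sub_two_lt_rho {V : Type*} [Fintype V] (H : SimpleGraph V) (x c : V)
    (hclique : ∀ u v, u ≠ x → v ≠ x → u ≠ v → H.Adj u v) (hc : H.Adj x c) :
    (Fintype.card V : ℝ) - 2 < rho H := by
  classical
  by_contra! hle
  -- The indicator of the clique has Rayleigh quotient n - 2. If ρ were no larger, it would be an
  -- eigenvector vanishing at `x`, which the neighbour `c` of `x` prevents.
  let y : V → ℝ := fun u => if u = x then 0 else 1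
  have hrow : ∀ v, (∑ w, if H.Adj v w then y v * y w else 0) =
      ((Fintype.card V : ℝ) - 2) * y v ^ 2 := by
    intro v
    by_cases hv : v = x
    · simp [y, hv]
    · have hterm : ∀ w, (if H.Adj v w then y v * y w else 0) =
          1 - (if w = v then 1 else 0) - if w = x then 1 else 0 := by
        intro w
        by_cases hwx : w = x
        · have : x ≠ v := fun h => hv h.symm
          simp [y, hwx, this]
        · by_cases hwv : w = v
          · simp [hwv, hv]
          · simp [y, hwx, hwv, hv, hclique v w hv hwx (Ne.symm hwv)]
      simp only [hterm, Finset.sum_sub_distrib]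
      simp [y, hv]
      ring
  have hy := eq_rho_mul_of_le_sum H y (by
    simp only [hrow, ← Finset.mul_sum]
    exact mul_le_mul_of_nonneg_right hle (by positivity)) x
  have h0 : rho H * y x = 0 := by simp [y]
  rw [h0, Finset.sum_eq_zero_iff_of_nonneg fun w _ => by
    simp only [y]; split_ifs <;> norm_num] at hy
  have := hy c (Finset.mem_univ c)
  simp [hc, y, hc.ne'] at this

theorem sub_two_lt_rho_extremalGraph {n b : ℕ} (hb : 2 ≤ b) (hn : b ≤ n) :
    (n : ℝ) - 2 < rho (extremalGraph n b) := by
  have := card_sub_two_lt_rho (extremalGraph n b) (Sum.inr (Sum.inl 0)) (Sum.inl ⟨0, by omega⟩)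
    (fun u v hu hv huv => by simp [extremalGraph_adj_iff, hu, hv, huv])
    (by simp [extremalGraph_adj_iff])
  rwa [card_extremalGraph_vertices (by omega) hn] at this

theorem not_hasAllFractionalFactors_of_iso {V : Type*} [Fintype V] {G : SimpleGraph V}
    {a b n : ℕ} (hab : a ≤ b) (hb : 1 ≤ b) (e : G ≃g extremalGraph n b) :
    ¬ HasAllFractionalFactors G a b := by
  classical
  intro h
  have hle := (h (fun _ => b) (fun _ => hb) fun _ => ⟨hab, le_rfl⟩).le_degree
    (e.symm (Sum.inr (Sum.inl 0)))
  have hsub : G.neighborFinset (e.symm (Sum.inr (Sum.inl 0))) ⊆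
      Finset.univ.image fun i : Fin (b - 1) => e.symm (Sum.inl i) := by
    intro w hw
    rw [SimpleGraph.mem_neighborFinset] at hw
    have hadj := e.map_adj_iff.2 hw
    rw [e.apply_symm_apply, extremalGraph_adj_iff] at hadj
    obtain ⟨i, hi⟩ := Sum.isLeft_iff.1 (hadj.2.1 rfl)
    exact Finset.mem_image.2 ⟨i, Finset.mem_univ i, by rw [← hi, e.symm_apply_apply]⟩
  have hcard := (Finset.card_le_card hsub).trans Finset.card_image_le
  rw [SimpleGraph.card_neighborFinset_eq_degree, Finset.card_univ, Fintype.card_fin] at hcard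
  have : b ≤ b - 1 := le_trans (by convert hle) hcard
  omega

/-- A graph with a vertex of degree less than `b` is a spanning subgraph of `H_{n,b}`. -/
theorem exists_le_comap_extremalGraph {V : Type*} [Fintype V] (G : SimpleGraph V)
    [DecidableRel G.Adj] {b n : ℕ} (hcard : Fintype.card V = n) (hb : 1 ≤ b) (hn : b ≤ n) (x : V)
    (hx : G.degree x ≤ b - 1) :
    ∃ e : V ≃ Fin (b - 1) ⊕ (Fin 1 ⊕ Fin (n - b)), G ≤ (extremalGraph n b).comap e := by
  classical
  -- The neighbourhood of `x` is enlarged to exactly b - 1 vertices, which will play the role of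
  -- K_{b-1}.
  obtain ⟨N, hN1, hN2, hN⟩ := Finset.exists_subsuperset_card_eq
    (s := G.neighborFinset x) (t := Finset.univ.erase x) (n := b - 1)
    (fun w hw => by
      rw [SimpleGraph.mem_neighborFinset] at hw
      simpa using hw.ne')
    (by rwa [SimpleGraph.card_neighborFinset_eq_degree])
    (by rw [Finset.card_erase_of_mem (Finset.mem_univ x), Finset.card_univ]; omega)
  have hxN : x ∉ N := fun h => by simpa using hN2 h
  let α : {w // w ∈ N} ≃ Fin (b - 1) := Fintype.equivOfCardEq (by simp [hN])
  let σ : {w // ¬ w ∈ N} ≃ Fin 1 ⊕ Fin (n - b) := Fintype.equivOfCardEq (by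
    rw [Fintype.card_subtype_compl, hcard, Fintype.card_coe, hN]
    simp only [Fintype.card_sum, Fintype.card_fin]
    omega)
  -- The swap sends `x` to the vertex of K_1.
  let τ := σ.trans (Equiv.swap (σ ⟨x, hxN⟩) (Sum.inl 0))
  let e := (Equiv.sumCompl (· ∈ N)).symm.trans (Equiv.sumCongr α τ)
  have hex : e x = Sum.inr (Sum.inl 0) := by
    simp [e, Equiv.sumCompl_symm_apply_of_neg hxN, τ]
  have heN : ∀ w ∈ N, (e w).isLeft := by
    intro w hw
    simp [e, Equiv.sumCompl_symm_apply_of_pos hw]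
  have hinj : ∀ w, e w = Sum.inr (Sum.inl 0) → w = x := fun w hw => e.injective (hw.trans hex.symm)
  refine ⟨e, fun u w huw => ?_⟩
  rw [SimpleGraph.comap_adj, extremalGraph_adj_iff]
  refine ⟨fun h => huw.ne (e.injective h), fun h => heN w (hN1 ?_), fun h => heN u (hN1 ?_)⟩
  · rw [SimpleGraph.mem_neighborFinset, ← hinj u h]
    exact huw
  · rw [SimpleGraph.mem_neighborFinset, ← hinj w h]
    exact huw.symm

/-- A proper spanning subgraph of H_{n,b} has smaller spectral radius: since b ≥ 2, the part K_{b-1}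
contains a dominating vertex. -/
theorem nonempty_iso_extremalGraph {V : Type*} [Fintype V] (G : SimpleGraph V)
    [DecidableRel G.Adj] {b n : ℕ} (hcard : Fintype.card V = n) (hb : 2 ≤ b) (hn : b ≤ n) (x : V)
    (hx : G.degree x ≤ b - 1) (hrho : rho (extremalGraph n b) ≤ rho G) :
    Nonempty (G ≃g extremalGraph n b) := by
  obtain ⟨e, he⟩ := exists_le_comap_extremalGraph G hcard (by omega) hn x hx
  have hiso := SimpleGraph.Iso.comap e (extremalGraph n b)
  rcases he.eq_or_lt with h | h
  · rw [h]
    exact ⟨hiso⟩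
  · refine absurd hrho (not_le.2 ?_)
    rw [← rho_congr hiso]
    refine rho_lt_rho_of_lt h (e.symm (Sum.inl ⟨0, by omega⟩)) fun v hv => ?_
    rw [SimpleGraph.comap_adj, extremalGraph_adj_iff, e.apply_symm_apply]
    refine ⟨fun h => hv ?_, by simp, by simp⟩
    rw [h, e.symm_apply_apply]

end ExtremalGraph

/-! ### Counting the edges that a violated cut forces to be missing. -/

section Counting

-- Exactly |T|(n - |S| - 1) - d ordered pairs of distinct vertices in T × Sᶜ are non-adjacent.
-- Removing them in both orders counts only pairs inside T twice, and the last term is the number of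
-- such pairs.
open Classical in
theorem sum_degree_le_of_cut {V : Type*} [Fintype V] (G : SimpleGraph V) (S T : Finset V)
    (hST : Disjoint S T) :
    ∑ v, (G.degree v : ℝ) ≤ (Fintype.card V : ℝ) * (Fintype.card V - 1)
      - 2 * (T.card * ((Fintype.card V : ℝ) - S.card - 1)
        - ∑ v ∈ T, ∑ w ∈ Sᶜ, if G.Adj v w then (1 : ℝ) else 0)
      + T.card * ((T.card : ℝ) - 1) := by
  let A : V → V → ℝ := fun v w => if G.Adj v w then 1 else 0
  let D : V → V → ℝ := fun v w => 1 - if v = w then 1 else 0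
  have hTS : ∀ v ∈ T, v ∈ Sᶜ := fun v hv => Finset.mem_compl.2 (Finset.disjoint_right.1 hST hv)
  have hAD : ∀ v w, A v w ≤ D v w := by
    intro v w
    by_cases h : v = w
    · simp [A, D, h]
    · simp only [A, D, h, if_false]
      split_ifs <;> norm_num
  have hA0 : ∀ v w, 0 ≤ A v w := by
    intro v w
    simp only [A]
    split_ifs <;> norm_num
  have hpt : ∀ v w, A v w ≤ D v w - (if v ∈ T then if w ∈ Sᶜ then D v w - A v w else 0 else 0)
      - (if w ∈ T then if v ∈ Sᶜ then D w v - A w v else 0 else 0)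
      + if v ∈ T then if w ∈ T then D v w else 0 else 0 := by
    intro v w
    have hD : D w v = D v w := by simp only [D, eq_comm]
    have hA : A w v = A v w := by simp only [A, G.adj_comm]
    have h1 := hAD v w
    have h2 := hA0 v w
    rw [hD, hA]
    split_ifs <;> linarith
  have hsum := Finset.sum_le_sum fun v (_ : v ∈ Finset.univ) =>
    Finset.sum_le_sum fun w (_ : w ∈ Finset.univ) => hpt v w
  simp only [Finset.sum_add_distrib, Finset.sum_sub_distrib] at hsum
  rw [Finset.sum_comm (f := fun v w => if w ∈ T then if v ∈ Sᶜ then D w v - A w v else 0 else 0)]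
    at hsum
  have hin : ∀ (P Q : Finset V) (F : V → V → ℝ),
      ∑ v, ∑ w, (if v ∈ P then if w ∈ Q then F v w else 0 else 0) = ∑ v ∈ P, ∑ w ∈ Q, F v w := by
    intro P Q F
    have hrow : ∀ v, ∑ w, (if v ∈ P then if w ∈ Q then F v w else 0 else 0) =
        if v ∈ P then ∑ w ∈ Q, F v w else 0 := by
      intro v
      split_ifs <;> simp
    simp [hrow]
  have hDsum : ∀ (P Q : Finset V), P ⊆ Q →
      ∑ v ∈ P, ∑ w ∈ Q, D v w = P.card * ((Q.card : ℝ) - 1) := by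
    intro P Q hPQ
    rw [← nsmul_eq_mul]
    refine Finset.sum_eq_card_nsmul fun v hv => ?_
    simp [D, Finset.sum_sub_distrib, hPQ hv]
  rw [hin, hin] at hsum
  simp only [Finset.sum_sub_distrib] at hsum
  rw [hDsum _ _ hTS, hDsum _ _ (Finset.Subset.refl T), hDsum _ _ (Finset.Subset.refl _),
    Finset.card_univ, Finset.card_compl, Nat.cast_sub (Finset.card_le_univ S)] at hsum
  have hdeg : ∑ v, (G.degree v : ℝ) = ∑ v, ∑ w, A v w := by
    refine Finset.sum_congr rfl fun v _ => ?_
    simp [A, SimpleGraph.card_neighborFinset_eq_degree, ← SimpleGraph.neighborFinset_eq_filter]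
  rw [hdeg]
  linarith

/-- The right side is the lower bound for the degree sum in `lt_sum_degree_of_lt_rho`. After d is
replaced by its maximum bt - 1 - as, the variable s enters with coefficient a - t, which dictates
the case split. -/
theorem cut_bound_of_two_le {a b n s t d : ℝ} (ha : 1 ≤ a) (hab : a + 1 ≤ b)
    (hn : 3 * b * (b + a + 1) + 7 * a ≤ a * n) (hs : 0 ≤ s) (ht : 2 ≤ t) (hst : s + t ≤ n)
    (hd : 0 ≤ d) (hcut : a * s + d + 1 ≤ b * t) :
    n * (n - 1) - 2 * (t * (n - s - 1) - d) + t * (t - 1) ≤ (n - 2) ^ 2 + n - 1 := by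
  suffices h : (n - 2) + 1 / 2 ≤ t * (n - s - 1) - (b * t - 1 - a * s) - t * (t - 1) / 2 by
    nlinarith
  have hn' : 3 * b + 7 ≤ n := by
    by_contra! hlt
    nlinarith
  -- For t ≤ a the term in s is nonnegative and can be dropped.
  rcases le_total t a with hta | hta
  · have h1 : 0 ≤ (a - t) * s := mul_nonneg (by linarith) hs
    nlinarith [mul_nonneg (sub_nonneg.2 ht) (sub_nonneg.2 hn'),
      mul_nonneg (sub_nonneg.2 ht) (sub_nonneg.2 (hta.trans (by linarith : a ≤ b)))]
  -- For moderate t, `hcut` with d ≥ 0 gives as ≤ bt - 1, and inserting the bound on n leaves a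
  -- concave quadratic in t, controlled by (t - 2)(2b + 2.5 - t) ≥ 0. For larger t, the bound s ≤ n
  -- - t is brought in.
  · rcases le_total t (2 * b + 2.5) with htb | htb
    · have h1 : (t - a) * (a * s) ≤ (t - a) * (b * t - 1) :=
        mul_le_mul_of_nonneg_left (by linarith) (by linarith)
      have h2 := mul_le_mul_of_nonneg_left hn (by linarith : 0 ≤ t - 1)
      have h3 : 0 ≤ (t - 2) * (2 * b + 2.5 - t) := mul_nonneg (by linarith) (by linarith)
      have h4 : 0 ≤ b * ((t - 2) * (2 * b + 2.5 - t)) := mul_nonneg (by linarith) h3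
      have h5 : 0 ≤ a * ((t - 2) * (2 * b + 2.5 - t)) := mul_nonneg (by linarith) h3
      refine le_of_mul_le_mul_left ?_ (by linarith : 0 < a)
      have h6 : 0 ≤ (t - 2) * (b * (b - 1)) :=
        mul_nonneg (by linarith) (mul_nonneg (by linarith) (by linarith))
      have h7 : 0 ≤ (t - 2) * (a * b) :=
        mul_nonneg (by linarith) (mul_nonneg (by linarith) (by linarith))
      have h8 : 0 ≤ (t - 2) * a := mul_nonneg (by linarith) (by linarith)
      have h9 : 0 ≤ (t - 2) * b := mul_nonneg (by linarith) (by linarith)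
      have h10 : 0 ≤ b * (b - 1) := mul_nonneg (by linarith) (by linarith)
      have h11 : 0 ≤ a * (b - 1) := mul_nonneg (by linarith) (by linarith)
      nlinarith
    · have h1 : (t - a) * s ≤ (t - a) * (n - t) :=
        mul_le_mul_of_nonneg_left (by linarith) (by linarith)
      have h2 : 0 ≤ (a - 1) * (n - t) := mul_nonneg (by linarith) (by linarith)
      have h3 : 0 ≤ t * (t - (2 * b + 2.5)) := mul_nonneg (by linarith) (by linarith)
      nlinarith

end Counting

end FracFactor

/-! ### The equivalence. -/

theorem theorem1p8 {V : Type*} [Fintype V] (G : SimpleGraph V) (a b n : ℕ)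
    (ha : 1 ≤ a) (hab : a < b) (hcard : Fintype.card V = n)
    (hn : 3 * (b : ℝ) * ((b : ℝ) + (a : ℝ) + 1) / (a : ℝ) + 7 ≤ (n : ℝ))
    (hrho : FracFactor.rho (FracFactor.extremalGraph n b) ≤ FracFactor.rho G) :
    FracFactor.HasAllFractionalFactors G a b ↔
      ¬ Nonempty (G ≃g FracFactor.extremalGraph n b) := by
  classical
  have haR : (1 : ℝ) ≤ a := by exact_mod_cast ha
  have habR : (a : ℝ) + 1 ≤ b := by exact_mod_cast hab
  have hnR : 3 * (b : ℝ) * (b + a + 1) + 7 * a ≤ a * n := by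
    rw [div_add' _ _ _ (by positivity), div_le_iff₀ (by positivity)] at hn
    linarith
  have hbn : b ≤ n := by
    have : (b : ℝ) ≤ n := by
      by_contra! hlt
      nlinarith
    exact_mod_cast this
  refine ⟨fun h ⟨e⟩ => FracFactor.not_hasAllFractionalFactors_of_iso hab.le (by omega) e h,
    fun hiso p _ hp => FracFactor.hasFractionalFactor_of_cut G p fun S T hST => ?_⟩
  by_contra! hlt
  set d := ∑ v ∈ T, ∑ w ∈ Sᶜ, if G.Adj v w then 1 else 0 with hd
  have hpT : ∑ v ∈ T, p v ≤ T.card * b := T.sum_le_card_nsmul p b fun v _ => (hp v).2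
  have hpS : S.card * a ≤ ∑ v ∈ S, p v := S.card_nsmul_le_sum p a fun v _ => (hp v).1
  -- The 1 comes from integrality of the violated cut inequality.
  have hcut : a * S.card + d + 1 ≤ b * T.card := by
    rw [mul_comm a, mul_comm b]
    omega
  rcases Nat.lt_or_ge T.card 2 with ht | ht
  · have ht1 : T.card = 1 := by
      have : T.card ≠ 0 := fun h => by simp [h] at hcut
      omega
    obtain ⟨x, rfl⟩ := Finset.card_eq_one.1 ht1
    refine hiso (FracFactor.nonempty_iso_extremalGraph G hcard (by omega) hbn x ?_ hrho)
    -- Each neighbour of `x` lies in S or is counted by `d`; with a ≥ 1 and `hcut` this gives degree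
    -- at most b - 1.
    have hdeg : G.degree x ≤ S.card + d := by
      rw [hd, Finset.sum_singleton, Finset.sum_boole, ← SimpleGraph.card_neighborFinset_eq_degree]
      refine (Finset.card_le_card ?_).trans (Finset.card_union_le _ _)
      intro w hw
      rw [SimpleGraph.mem_neighborFinset] at hw
      by_cases h : w ∈ S <;> simp [h, hw]
    have : S.card ≤ a * S.card := Nat.le_mul_of_pos_left _ ha
    rw [ht1, mul_one] at hcut
    omega
  · have hst : S.card + T.card ≤ n := by
      rw [← Finset.card_union_of_disjoint hST, ← hcard]
      exact Finset.card_le_univ _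
    have hlow := FracFactor.lt_sum_degree_of_lt_rho G (by omega) (by
      rw [hcard]
      exact (FracFactor.sub_two_lt_rho_extremalGraph (by omega) hbn).trans_le hrho)
    have hup := FracFactor.sum_degree_le_of_cut G S T hST
    have hdR : (∑ v ∈ T, ∑ w ∈ Sᶜ, if G.Adj v w then (1 : ℝ) else 0) = (d : ℝ) := by
      rw [hd]
      push_cast
      rfl
    rw [hdR, hcard] at hup
    rw [hcard] at hlow
    have hnum := FracFactor.cut_bound_of_two_le (a := a) (b := b) (n := n) (s := S.card)
      (t := T.card) (d := d) haR habR hnR (by positivity) (by exact_mod_cast ht)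
      (by exact_mod_cast hst) (by positivity) (by exact_mod_cast hcut)
    linarith
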